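/- Let $n\in\mathbb N$, $n\ge 1$, and let $s:\mathbb R^n\setminus\{0\}\to\mathbb R$ be a smooth weakly singular kernel, meaning that $\lim_{h\to0^+}\int_{h<|x|\le1}s(x)\,dx$ exists in $\mathbb R$, and that $s$ has the following two properties. (Dilation) There are $\delta\in(0,n)$ and a smooth function $\rho:\mathbb R^n\to\mathbb R$, not identically zero, with $s(x)=|x|^{\delta-n}\rho(x/|x|)$ for all $x\ne0$. (Symmetry) There is an integer $0\le\kappa\le n$ such that $s$ is odd in each of the variables $x_1,\dots,x_\kappa$ and even in each of the variables $x_{\kappa+1},\dots,x_n$. For $h>0$ and a compactly supported function $f$ put $T_h^0[f]=h^n\sum_{\beta\in\mathbb Z^n\setminus\{0\}}f(\beta h)$. For a multi-index $\xi\in\mathbb N_0^n$ write $|\xi|_1=\sum_j\xi_j$ and $x^\xi=\prod_j x_j^{\xi_j}$. Fix $\xi\in\mathbb N_0^n$. Then there is a constant $c(\xi)\in\mathbb R$, depending only on $s$ and $\xi$, such that the following holds for all integers $p\ge0$ and $N>\max\{p+1+\delta+|\xi|_1,\,n\}$ and every real-valued $g\in C_c^N(\mathbb R^n)$ with $\partial^kg(0)=0$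 for all multi-indices $k$ with $1\le|k|_1\le p$. The function $g\cdot s\cdot x^\xi$ is integrable on $\mathbb R^n$, and there is a constant $C$, independent of $h$, such that for all $h>0$ $$\left|\int_{\mathbb R^n}g(x)\,s(x)\,x^\xi\,dx-T_h^0[g\cdot s\cdot x^\xi]-g(0)\,h^{|\xi|_1+\delta}\,c(\xi)\right|\le C\,h^{p+1+\delta+|\xi|_1}.$$ -/

import Mathlib

open MeasureTheory Filter Topology
open scoped ContDiff

noncomputable section

namespace PuncturedTrapezoid

/-- The order `|k|₁ = k₁ + ⋯ + kₙ` of a multi-index. -/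
def order {n : ℕ} (k : Fin n → ℕ) : ℕ := ∑ j, k j

/-- The monomial `x^k = ∏ⱼ xⱼ ^ kⱼ`. -/
def monomial {n : ℕ} (k : Fin n → ℕ) (x : EuclideanSpace ℝ (Fin n)) : ℝ := ∏ j, x j ^ k j

/-- The partial derivative `∂ⱼ u` with respect to the `j`-th coordinate. -/
def partialDeriv {n : ℕ} (j : Fin n) (u : EuclideanSpace ℝ (Fin n) → ℝ) :
    EuclideanSpace ℝ (Fin n) → ℝ :=
  fun x => lineDeriv ℝ u x (EuclideanSpace.single j 1)

/-- The mixed partial derivative `∂^k u = ∂₁^{k₁} ⋯ ∂ₙ^{kₙ} u` of a multi-index `k`. -/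
def multiDeriv {n : ℕ} (k : Fin n → ℕ) (u : EuclideanSpace ℝ (Fin n) → ℝ) :
    EuclideanSpace ℝ (Fin n) → ℝ :=
  (List.finRange n).foldr (fun j v => (partialDeriv j)^[k j] v) u

/-- The reflection `x ↦ (x₁, …, -xⱼ, …, xₙ)`. -/
def reflect {n : ℕ} (j : Fin n) (x : EuclideanSpace ℝ (Fin n)) : EuclideanSpace ℝ (Fin n) :=
  WithLp.toLp 2 (Function.update x.ofLp j (-x j))

/-- `s` is a weakly singular kernel on `ℝⁿ \ {0}` with the dilation property of exponent `δ` and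
the symmetry property with `κ` odd arguments. The value `s 0` carries no meaning. -/
structure IsWeaklySingularKernel (n : ℕ) (δ : ℝ) (κ : ℕ)
    (s : EuclideanSpace ℝ (Fin n) → ℝ) : Prop where
  /-- the truncated integrals over `h < |x| ≤ 1` converge as `h → 0` -/
  weakly_singular : ∃ L : ℝ,
    Tendsto (fun h : ℝ => ∫ x in {x : EuclideanSpace ℝ (Fin n) | h < ‖x‖ ∧ ‖x‖ ≤ 1}, s x)
      (𝓝[>] 0) (𝓝 L)
  smooth : ContDiffOn ℝ ∞ s {0}ᶜ
  delta_pos : 0 < δ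
  delta_lt : δ < n
  dilation : ∃ ρ : EuclideanSpace ℝ (Fin n) → ℝ, ContDiff ℝ ∞ ρ ∧ ρ ≠ 0 ∧
    ∀ x, x ≠ 0 → s x = ‖x‖ ^ (δ - n) * ρ (‖x‖⁻¹ • x)
  kappa_le : κ ≤ n
  /-- odd in the first `κ` coordinates -/
  odd_symm : ∀ j : Fin n, (j : ℕ) < κ → ∀ x, x ≠ 0 → s x = -s (reflect j x)
  /-- even in the remaining coordinates -/
  even_symm : ∀ j : Fin n, κ ≤ (j : ℕ) → ∀ x, x ≠ 0 → s x = s (reflect j x)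

/-- The grid point `β h` of the mesh of size `h`, for `β ∈ ℤⁿ`. -/
def gridPoint {n : ℕ} (h : ℝ) (β : Fin n → ℤ) : EuclideanSpace ℝ (Fin n) :=
  WithLp.toLp 2 (fun j => (β j : ℝ) * h)

/-- The punctured-hole trapezoidal rule `T_h⁰[f] = hⁿ ∑_{β ∈ ℤⁿ \ {0}} f(β h)`. For compactly
supported `f` and `h > 0` only finitely many terms are nonzero. -/
def puncturedTrapezoid {n : ℕ} (h : ℝ) (f : EuclideanSpace ℝ (Fin n) → ℝ) : ℝ :=
  h ^ n * ∑' β : {β : Fin n → ℤ // β ≠ 0}, f (gridPoint h β.1)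

end PuncturedTrapezoid

end

/-! Let `D F = F - A F`, where `A` averages over the translate of the unit cell. Averages over the
unit grid add up to `∫ F`, so the grid sum of `D F` is the negative of the trapezoidal error of `F`;
as `∫ D F = 0` for compactly supported `F`, the same error is minus the grid sum of `D^N F` for
every `N ≥ 1`. Moreover `D^N F` is controlled by the `N`-th derivative of `F` nearby
(`norm_cellDefect_iterate_le`). So if derivatives decay fast enough, the sum converges absolutely
even without compact support.

The function `σ = s x^ξ` is homogeneous of degree `d = δ - n + |ξ|₁`. Rescaling to the unit grid
turns the error at mesh size `h` into `h^(n+d) E(g(h·)σ)`, with `E` the error at mesh size 1 and `n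
+ d = |ξ|₁ + δ`. A cutoff `χ` splits `E` into a near part `E(χ ·)`, an integrable singularity
together with a finite sum, and a far part, the sum of `N`-fold defects of `(1 - χ) ·`. Both parts
are linear and are bounded by any constant `B` for which the `a`-th derivatives are at most `B
|x|^(m-a)`, as long as `-n < m` and `m + n < N`.

Write `g(hx) = g(0) + (g(hx) - g(0))`. The first term gives `g(0)` times a constant depending on `σ`
and `N` only. By the vanishing derivatives and Taylor-type estimates, the second, multiplied by `σ`,
satisfies such a bound with `m = p + 1 + d` and `B` proportional to `h^(p+1)`, which is the
remainder (`exists_abs_puncturedError_sub_le`). The constant is a limit of errors in which `N` does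
not occur, hence independent of `N` (`errorConst_congr`). -/

noncomputable section

namespace PuncturedTrapezoid

/-! ### Cell averages, their defects, and the trapezoidal error on the unit grid -/

section CellDefect

/-- The half-open unit cell `[0, 1)ⁿ`. -/
def unitCell (n : ℕ) : Set (EuclideanSpace ℝ (Fin n)) := {x | ∀ j, 0 ≤ x j ∧ x j < 1}

/-- The average of `F` over the unit cell attached to a point. -/
def cellAverage {n : ℕ} {G : Type} [NormedAddCommGroup G] [NormedSpace ℝ G]
    (F : EuclideanSpace ℝ (Fin n) → G) (x : EuclideanSpace ℝ (Fin n)) : G :=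
  ∫ y in unitCell n, F (x + y)

/-- The difference between a function and its cell averages. -/
def cellDefect {n : ℕ} {G : Type} [NormedAddCommGroup G] [NormedSpace ℝ G]
    (F : EuclideanSpace ℝ (Fin n) → G) (x : EuclideanSpace ℝ (Fin n)) : G :=
  F x - cellAverage F x

variable {n : ℕ} {G : Type} [NormedAddCommGroup G] [NormedSpace ℝ G]

lemma measurableSet_unitCell : MeasurableSet (unitCell n) := by
  have : unitCell n = ⋂ j, {x : EuclideanSpace ℝ (Fin n) | 0 ≤ x j ∧ x j < 1} := by
    ext; simp [unitCell]
  rw [this]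
  refine MeasurableSet.iInter fun j => ?_
  have hm : Measurable fun x : EuclideanSpace ℝ (Fin n) => x j := by fun_prop
  exact hm (measurableSet_Ico (a := (0 : ℝ)) (b := 1))

lemma volume_unitCell : volume (unitCell n) = 1 := by
  have h : unitCell n = WithLp.ofLp ⁻¹' (Set.univ.pi fun _ : Fin n => Set.Ico (0 : ℝ) 1) := by
    ext x; simp [unitCell, Set.mem_pi]
  rw [h, (PiLp.volume_preserving_ofLp (Fin n)).measure_preimage
    (MeasurableSet.univ_pi fun _ => measurableSet_Ico).nullMeasurableSet, Real.volume_pi_Ico]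
  simp

instance : IsProbabilityMeasure (volume.restrict (unitCell n)) :=
  ⟨by simp [volume_unitCell]⟩

lemma norm_le_of_mem_unitCell {y : EuclideanSpace ℝ (Fin n)} (hy : y ∈ unitCell n) :
    ‖y‖ ≤ √n := by
  rw [EuclideanSpace.norm_eq]
  apply Real.sqrt_le_sqrt
  calc ∑ i, ‖y i‖ ^ 2 ≤ ∑ _i : Fin n, (1 : ℝ) := by
        refine Finset.sum_le_sum fun i _ => ?_
        rw [Real.norm_eq_abs, sq_abs]
        nlinarith [(hy i).1, (hy i).2]
    _ = n := by simp

lemma integrableOn_unitCell_comp_add {G : Type} [NormedAddCommGroup G]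
    {F : EuclideanSpace ℝ (Fin n) → G} (hF : Continuous F)
    (x : EuclideanSpace ℝ (Fin n)) :
    Integrable (fun y => F (x + y)) (volume.restrict (unitCell n)) := by
  have hK : IntegrableOn (fun y => F (x + y)) (Metric.closedBall 0 (√n)) :=
    ContinuousOn.integrableOn_compact (isCompact_closedBall _ _) (by fun_prop)
  exact hK.mono_set fun y hy => by simpa using norm_le_of_mem_unitCell hy

lemma cellDefect_eq [CompleteSpace G] {F : EuclideanSpace ℝ (Fin n) → G} (hF : Continuous F)
    (x : EuclideanSpace ℝ (Fin n)) :
    cellDefect F x = ∫ y in unitCell n, (F x - F (x + y)) := by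
  rw [integral_sub (integrable_const _) (integrableOn_unitCell_comp_add hF x)]
  simp [cellDefect, cellAverage]

lemma hasFDerivAt_cellAverage {F : EuclideanSpace ℝ (Fin n) → G} (hF : ContDiff ℝ 1 F)
    (x : EuclideanSpace ℝ (Fin n)) :
    HasFDerivAt (cellAverage F) (cellAverage (fderiv ℝ F) x) x := by
  have hF' : Continuous (fderiv ℝ F) := hF.continuous_fderiv one_ne_zero
  obtain ⟨C, hC⟩ := (isCompact_closedBall (x : EuclideanSpace ℝ (Fin n))
    (1 + √n)).exists_bound_of_continuousOn hF'.continuousOn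
  refine hasFDerivAt_integral_of_dominated_of_fderiv_le (s := Metric.ball x 1)
    (F := fun x y => F (x + y)) (F' := fun x y => fderiv ℝ F (x + y)) (bound := fun _ => C)
    (Metric.ball_mem_nhds _ one_pos) (Eventually.of_forall fun z => ?_)
    (integrableOn_unitCell_comp_add hF.continuous x)
    (integrableOn_unitCell_comp_add hF' x).aestronglyMeasurable ?_ (integrable_const _) ?_
  · exact (integrableOn_unitCell_comp_add hF.continuous z).aestronglyMeasurable
  · filter_upwards [ae_restrict_mem measurableSet_unitCell] with y hy z hz
    refine hC _ ?_
    have h1 := norm_le_of_mem_unitCell hy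
    rw [Metric.mem_ball, dist_eq_norm] at hz
    rw [Metric.mem_closedBall, dist_eq_norm]
    calc ‖z + y - x‖ = ‖(z - x) + y‖ := by congr 1; abel
      _ ≤ ‖z - x‖ + ‖y‖ := norm_add_le _ _
      _ ≤ _ := by linarith
  · refine Eventually.of_forall fun y z _ => ?_
    have := ((hF.differentiable one_ne_zero) (z + y)).hasFDerivAt
    exact (hasFDerivAt_comp_add_right y).2 this

/-- Averaging commutes with differentiation, so a derivative passes through all the defects of an
iterate. -/
lemma fderiv_cellDefect {F : EuclideanSpace ℝ (Fin n) → G} (hF : ContDiff ℝ 1 F) :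
    fderiv ℝ (cellDefect F) = cellDefect (fderiv ℝ F) := by
  ext1 x
  exact (((hF.differentiable one_ne_zero) x).hasFDerivAt.sub (hasFDerivAt_cellAverage hF x)).fderiv

lemma continuous_cellAverage {F : EuclideanSpace ℝ (Fin n) → G} (hF : Continuous F) :
    Continuous (cellAverage F) := by
  refine continuous_iff_continuousAt.2 fun x => ?_
  obtain ⟨C, hC⟩ := (isCompact_closedBall (x : EuclideanSpace ℝ (Fin n))
    (1 + √n)).exists_bound_of_continuousOn hF.continuousOn
  refine continuousAt_of_dominated (F := fun x y => F (x + y)) (bound := fun _ => C)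
    (Eventually.of_forall fun z => (integrableOn_unitCell_comp_add hF z).aestronglyMeasurable)
    ?_ (integrable_const _) (Eventually.of_forall fun y => by fun_prop)
  filter_upwards [Metric.ball_mem_nhds x one_pos] with z hz
  filter_upwards [ae_restrict_mem measurableSet_unitCell] with y hy
  refine hC _ ?_
  have h1 := norm_le_of_mem_unitCell hy
  rw [Metric.mem_ball, dist_eq_norm] at hz
  rw [Metric.mem_closedBall, dist_eq_norm]
  calc ‖z + y - x‖ = ‖(z - x) + y‖ := by congr 1; abel
    _ ≤ ‖z - x‖ + ‖y‖ := norm_add_le _ _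
    _ ≤ _ := by linarith

lemma continuous_cellDefect {F : EuclideanSpace ℝ (Fin n) → G} (hF : Continuous F) :
    Continuous (cellDefect F) :=
  hF.sub (continuous_cellAverage hF)

lemma continuous_cellDefect_iterate {F : EuclideanSpace ℝ (Fin n) → G} (hF : Continuous F)
    (M : ℕ) : Continuous (cellDefect^[M] F) := by
  induction M with
  | zero => exact hF
  | succ M ih =>
    rw [Function.iterate_succ_apply']
    exact continuous_cellDefect ih

lemma contDiff_one_cellDefect {F : EuclideanSpace ℝ (Fin n) → G} (hF : ContDiff ℝ 1 F) :
    ContDiff ℝ 1 (cellDefect F) := by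
  rw [contDiff_one_iff_fderiv]
  refine ⟨fun x => (((hF.differentiable one_ne_zero) x).hasFDerivAt.sub
    (hasFDerivAt_cellAverage hF x)).differentiableAt, ?_⟩
  rw [fderiv_cellDefect hF]
  exact continuous_cellDefect (hF.continuous_fderiv one_ne_zero)

lemma contDiff_one_cellDefect_iterate {F : EuclideanSpace ℝ (Fin n) → G} (hF : ContDiff ℝ 1 F)
    (M : ℕ) : ContDiff ℝ 1 (cellDefect^[M] F) ∧
      fderiv ℝ (cellDefect^[M] F) = cellDefect^[M] (fderiv ℝ F) := by
  induction M with
  | zero => exact ⟨hF, rfl⟩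
  | succ M ih =>
    rw [Function.iterate_succ_apply', Function.iterate_succ_apply']
    exact ⟨contDiff_one_cellDefect ih.1, by rw [fderiv_cellDefect ih.1, ih.2]⟩

lemma norm_cellDefect_le [CompleteSpace G] {F : EuclideanSpace ℝ (Fin n) → G}
    (hF : ContDiff ℝ 1 F) {x : EuclideanSpace ℝ (Fin n)} {B : ℝ}
    (hB : ∀ z ∈ Metric.closedBall x (√n), ‖fderiv ℝ F z‖ ≤ B) :
    ‖cellDefect F x‖ ≤ √n * B := by
  rw [cellDefect_eq hF.continuous]
  have hB0 : 0 ≤ B := (norm_nonneg _).trans (hB x (Metric.mem_closedBall_self (by positivity)))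
  have : ∀ᵐ y ∂(volume.restrict (unitCell n)), ‖F x - F (x + y)‖ ≤ √n * B := by
    filter_upwards [ae_restrict_mem measurableSet_unitCell] with y hy
    have hy' := norm_le_of_mem_unitCell hy
    have := (convex_closedBall x (√n)).norm_image_sub_le_of_norm_fderiv_le (𝕜 := ℝ)
      (fun z _ => (hF.differentiable one_ne_zero) z) hB
      (x := x + y) (y := x) (by simpa using hy') (Metric.mem_closedBall_self (by positivity))
    refine this.trans ?_
    rw [sub_add_cancel_left, norm_neg, mul_comm]
    gcongr
  simpa using norm_integral_le_of_norm_le_const this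

/-- Each defect trades one derivative for a factor `√n` and enlarges the ball by `√n`, by the mean
value inequality. The target space varies in the induction because `F` is replaced by `fderiv ℝ F`.
-/
lemma norm_cellDefect_iterate_le (M : ℕ) : ∀ {G : Type} [NormedAddCommGroup G] [NormedSpace ℝ G]
    [CompleteSpace G] {F : EuclideanSpace ℝ (Fin n) → G} (_ : ContDiff ℝ M F)
    {x : EuclideanSpace ℝ (Fin n)} {B : ℝ}
    (_ : ∀ z ∈ Metric.closedBall x (M * √n), ‖iteratedFDeriv ℝ M F z‖ ≤ B),
    ‖cellDefect^[M] F x‖ ≤ √n ^ M * B := by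
  induction M with
  | zero =>
    intro G _ _ _ F hF x B hB
    simpa using hB x (by simp)
  | succ M ih =>
    intro G _ _ _ F hF x B hB
    have h1 : ContDiff ℝ 1 F := hF.of_le (by norm_cast; omega)
    have h2 : ContDiff ℝ M (fderiv ℝ F) := (contDiff_succ_iff_fderiv.1 (by exact_mod_cast hF)).2.2
    obtain ⟨h3, h4⟩ := contDiff_one_cellDefect_iterate h1 M
    rw [Function.iterate_succ_apply', pow_succ', mul_assoc]
    refine norm_cellDefect_le h3 fun z hz => ?_
    rw [h4]
    refine ih h2 fun w hw => ?_
    rw [norm_iteratedFDeriv_fderiv]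
    refine hB w ?_
    rw [Metric.mem_closedBall] at hz hw ⊢
    push_cast
    linarith [dist_triangle w z x]

lemma cellAverage_add {F H : EuclideanSpace ℝ (Fin n) → G} (hF : Continuous F)
    (hH : Continuous H) : cellAverage (F + H) = cellAverage F + cellAverage H := by
  ext1 x
  exact integral_add (integrableOn_unitCell_comp_add hF x) (integrableOn_unitCell_comp_add hH x)

lemma cellDefect_iterate_add {F H : EuclideanSpace ℝ (Fin n) → G} (hF : Continuous F)
    (hH : Continuous H) (M : ℕ) :
    cellDefect^[M] (F + H) = cellDefect^[M] F + cellDefect^[M] H := by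
  induction M with
  | zero => rfl
  | succ M ih =>
    simp only [Function.iterate_succ_apply', ih]
    ext1 x
    simp only [cellDefect, cellAverage_add (continuous_cellDefect_iterate hF M)
      (continuous_cellDefect_iterate hH M), Pi.add_apply]
    abel

lemma cellDefect_iterate_smul (a : ℝ) (F : EuclideanSpace ℝ (Fin n) → G) (M : ℕ) :
    cellDefect^[M] (a • F) = a • cellDefect^[M] F := by
  induction M with
  | zero => rfl
  | succ M ih =>
    simp only [Function.iterate_succ_apply', ih]
    ext1 x
    simp only [cellDefect, cellAverage, Pi.smul_apply, integral_smul, smul_sub]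

lemma hasCompactSupport_cellDefect {F : EuclideanSpace ℝ (Fin n) → G}
    (hF : HasCompactSupport F) : HasCompactSupport (cellDefect F) := by
  obtain ⟨r, hr⟩ := hF.isBounded.subset_closedBall (0 : EuclideanSpace ℝ (Fin n))
  have h0 : ∀ x, r < ‖x‖ → F x = 0 := fun x hx => by
    by_contra h
    have := hr (subset_tsupport _ h)
    simp at this
    linarith
  refine HasCompactSupport.of_support_subset_isCompact
    (isCompact_closedBall (0 : EuclideanSpace ℝ (Fin n)) (r + √n)) fun x hx => ?_
  by_contra h
  rw [mem_closedBall_zero_iff, not_le] at h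
  refine hx ?_
  have h1 : ∫ y in unitCell n, F (x + y) = ∫ y in unitCell n, (0 : G) := by
    refine setIntegral_congr_fun measurableSet_unitCell fun y hy => h0 _ ?_
    have := norm_le_of_mem_unitCell hy
    have := norm_sub_norm_le x (-y)
    rw [sub_neg_eq_add, norm_neg] at this
    linarith
  rw [cellDefect, cellAverage, h1, h0 x (by linarith [Real.sqrt_nonneg n])]
  simp

/-- Fubini and translation invariance; consequently cell defects have integral zero. -/
lemma integral_cellAverage [CompleteSpace G] {F : EuclideanSpace ℝ (Fin n) → G} (hF : Continuous F)
    (hFc : HasCompactSupport F) : ∫ x, cellAverage F x = ∫ x, F x := by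
  have hi : Integrable F := hF.integrable_of_hasCompactSupport hFc
  unfold cellAverage
  rw [integral_integral_swap]
  · have h (y : EuclideanSpace ℝ (Fin n)) : ∫ x, F (x + y) = ∫ x, F x :=
      integral_add_right_eq_self F y
    simp only [h, integral_const, probReal_univ, one_smul]
  · rw [integrable_prod_iff']
    · refine ⟨Eventually.of_forall fun y => hi.comp_add_right y, ?_⟩
      simp only [Function.uncurry,
        integral_add_right_eq_self (μ := (volume : Measure (EuclideanSpace ℝ (Fin n))))
          fun x => ‖F x‖]
      exact integrable_const _
    · have : Continuous (Function.uncurry fun x y => F (x + y)) := by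
        unfold Function.uncurry; fun_prop
      exact this.aestronglyMeasurable

/-- The averages over the cells of the unit grid add up to the integral. -/
lemma hasSum_cellAverage {F : EuclideanSpace ℝ (Fin n) → G} (hF : Integrable F) :
    HasSum (fun β : Fin n → ℤ => cellAverage F (gridPoint 1 β)) (∫ x, F x) := by
  -- The fibres of the coordinatewise floor are the translated cells, which makes them visibly a
  -- partition.
  have hset (β : Fin n → ℤ) : {x : EuclideanSpace ℝ (Fin n) | ∀ j, ⌊x j⌋ = β j} =
      (fun x => -gridPoint 1 β + x) ⁻¹' unitCell n := by
    ext x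
    simp only [Set.mem_ofPred_eq, Set.mem_preimage, unitCell, gridPoint, Int.floor_eq_iff,
      PiLp.add_apply, PiLp.neg_apply, mul_one]
    refine forall_congr' fun j => ⟨fun h => ⟨by linarith, by linarith⟩,
      fun h => ⟨by linarith, by linarith⟩⟩
  have hmeas (β : Fin n → ℤ) :
      MeasurableSet {x : EuclideanSpace ℝ (Fin n) | ∀ j, ⌊x j⌋ = β j} := by
    rw [hset]
    exact measurableSet_unitCell.preimage (by fun_prop)
  have key := hasSum_integral_iUnion (f := F) (μ := volume) hmeas
    (fun β γ hβγ => Set.disjoint_left.2 fun x hx hx' => hβγ (funext fun j => by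
      rw [← hx j, ← hx' j])) hF.integrableOn
  have huniv : (⋃ β : Fin n → ℤ, {x : EuclideanSpace ℝ (Fin n) | ∀ j, ⌊x j⌋ = β j}) =
      Set.univ := Set.eq_univ_of_forall fun x => Set.mem_iUnion.2 ⟨fun j => ⌊x j⌋, fun j => rfl⟩
  rw [huniv, setIntegral_univ] at key
  convert key using 2 with β
  rw [hset, cellAverage, ← integral_indicator measurableSet_unitCell, ← integral_indicator
    (measurableSet_unitCell.preimage (by fun_prop)),
    ← integral_add_left_eq_self (μ := (volume : Measure (EuclideanSpace ℝ (Fin n)))) _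
      (-gridPoint 1 β)]
  refine integral_congr_ae (Eventually.of_forall fun x => ?_)
  by_cases h : -gridPoint 1 β + x ∈ unitCell n <;>
    simp [Set.indicator, h]

lemma norm_gridPoint_coord_le (β : Fin n → ℤ) (j : Fin n) :
    |(β j : ℝ)| ≤ ‖gridPoint 1 β‖ := by
  simpa [gridPoint] using PiLp.norm_apply_le (gridPoint 1 β) j

lemma finite_setOf_norm_gridPoint_le (r : ℝ) :
    {β : Fin n → ℤ | ‖gridPoint 1 β‖ ≤ r}.Finite := by
  refine (Set.Finite.pi' (t := fun _ : Fin n => Set.Icc (-⌈r⌉) ⌈r⌉)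
    fun _ => Set.finite_Icc _ _).subset fun β hβ j => ?_
  have h1 := abs_le.1 ((norm_gridPoint_coord_le β j).trans (le_trans hβ (Int.le_ceil r)))
  exact ⟨by exact_mod_cast h1.1, by exact_mod_cast h1.2⟩

lemma finite_support_comp_gridPoint {G : Type} [NormedAddCommGroup G]
    {F : EuclideanSpace ℝ (Fin n) → G}
    (hF : HasCompactSupport F) :
    (Function.support fun β : Fin n → ℤ => F (gridPoint 1 β)).Finite := by
  obtain ⟨r, hr⟩ := hF.isBounded.subset_closedBall (0 : EuclideanSpace ℝ (Fin n))
  refine (finite_setOf_norm_gridPoint_le r).subset fun β hβ => ?_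
  simpa using hr (subset_tsupport _ hβ)

/-- The error of the trapezoidal rule on the unit grid, in terms of iterated cell defects. -/
lemma integral_sub_tsum_gridPoint [CompleteSpace G] {F : EuclideanSpace ℝ (Fin n) → G}
    (hF : Continuous F) (hFc : HasCompactSupport F) (M : ℕ) :
    (∫ x, F x) - ∑' β : Fin n → ℤ, F (gridPoint 1 β) =
      -∑' β : Fin n → ℤ, cellDefect^[M + 1] F (gridPoint 1 β) := by
  have hi : Integrable F := hF.integrable_of_hasCompactSupport hFc
  have hsum : ∑' β : Fin n → ℤ, cellDefect F (gridPoint 1 β) =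
      (∑' β : Fin n → ℤ, F (gridPoint 1 β)) - ∫ x, F x :=
    ((summable_of_hasFiniteSupport (finite_support_comp_gridPoint hFc)).hasSum.sub
      (hasSum_cellAverage hi)).tsum_eq
  induction M generalizing F with
  | zero => simp [hsum]
  | succ M ih =>
    have hc := continuous_cellDefect hF
    have hcc := hasCompactSupport_cellDefect hFc
    have hci : Integrable (cellDefect F) := hc.integrable_of_hasCompactSupport hcc
    rw [Function.iterate_succ_apply, ← ih hc hcc hci
      (((summable_of_hasFiniteSupport (finite_support_comp_gridPoint hcc)).hasSum.sub
        (hasSum_cellAverage hci)).tsum_eq), hsum]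
    have hav : Integrable (cellAverage F) := by
      have : cellAverage F = F - cellDefect F := by ext1 x; simp [cellDefect]
      rw [this]; exact hi.sub hci
    -- The integral term of the induction hypothesis for `cellDefect F` drops out, leaving its grid
    -- sum.
    have : ∫ x, cellDefect F x = 0 := by
      unfold cellDefect
      rw [integral_sub hi hav, integral_cellAverage hF hFc, sub_self]
    rw [this]; abel

/-- Summability over the unit grid of an integrable inverse power of `1 + ‖x‖`. -/
lemma summable_one_add_norm_gridPoint {a : ℝ} (ha : (n : ℝ) < a) :
    Summable fun β : Fin n → ℤ => (1 + ‖gridPoint (n := n) 1 β‖) ^ (-a) := by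
  have hint : Integrable fun x : EuclideanSpace ℝ (Fin n) => (1 + ‖x‖) ^ (-a) :=
    integrable_one_add_norm (by simpa using ha)
  have hcont : Continuous fun x : EuclideanSpace ℝ (Fin n) => (1 + ‖x‖) ^ (-a) :=
    (by fun_prop : Continuous fun x : EuclideanSpace ℝ (Fin n) => 1 + ‖x‖).rpow_const
      fun x => Or.inl (by positivity)
  have ha0 : 0 ≤ a := (Nat.cast_nonneg n).trans ha.le
  refine Summable.of_nonneg_of_le (fun β => by positivity) (fun β => ?_)
    ((hasSum_cellAverage hint).summable.mul_left ((1 + √n) ^ a))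
  -- Moving within a cell changes `1 + ‖x‖` by a factor of at most `1 + √n`, so the sum is dominated
  -- by an integral.
  have h1 : ∀ y ∈ unitCell n, (1 + √n) ^ (-a) * (1 + ‖gridPoint 1 β‖) ^ (-a) ≤
      (1 + ‖gridPoint 1 β + y‖) ^ (-a) := fun y hy => by
    rw [← Real.mul_rpow (by positivity) (by positivity)]
    refine Real.rpow_le_rpow_of_nonpos (by positivity) ?_ (by linarith)
    have h2 := norm_le_of_mem_unitCell hy
    have h3 := norm_add_le (gridPoint 1 β) y
    nlinarith [norm_nonneg (gridPoint 1 β), Real.sqrt_nonneg n]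
  have h2 := setIntegral_mono_on (integrable_const _) (integrableOn_unitCell_comp_add hcont
    (gridPoint 1 β)) measurableSet_unitCell h1
  rw [integral_const, probReal_univ, one_smul] at h2
  calc (1 + ‖gridPoint (n := n) 1 β‖) ^ (-a) =
      (1 + √n) ^ a * ((1 + √n) ^ (-a) * (1 + ‖gridPoint 1 β‖) ^ (-a)) := by
        rw [← mul_assoc, ← Real.rpow_add (by positivity)]; simp
    _ ≤ _ := by gcongr; exact h2

end CellDefect

/-! ### Derivative bounds by powers of the norm -/

section DerivBounds

variable {n : ℕ}

/-! ### From mixed partial derivatives to iterated Fréchet derivatives -/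

section MultiIndex

variable {u : EuclideanSpace ℝ (Fin n) → ℝ}

lemma partialDeriv_eq_fderiv (hu : Differentiable ℝ u) (j : Fin n) :
    partialDeriv j u = fun x => fderiv ℝ u x (EuclideanSpace.single j 1) :=
  funext fun x => (hu x).lineDeriv_eq_fderiv

lemma contDiff_partialDeriv {m : ℕ} (hu : ContDiff ℝ (m + 1 : ℕ) u) (j : Fin n) :
    ContDiff ℝ m (partialDeriv j u) := by
  rw [partialDeriv_eq_fderiv (hu.differentiable (by norm_cast)) j]
  exact (hu.fderiv_right (by norm_cast)).clm_apply contDiff_const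

lemma partialDeriv_comm (hu : ContDiff ℝ 2 u) (i j : Fin n) :
    partialDeriv i (partialDeriv j u) = partialDeriv j (partialDeriv i u) := by
  have h1 : Differentiable ℝ u := hu.differentiable two_ne_zero
  have h2 : ContDiff ℝ 1 (fderiv ℝ u) := hu.fderiv_right (by norm_num)
  have h3 : Differentiable ℝ (fderiv ℝ u) := h2.differentiable one_ne_zero
  have key (i j : Fin n) (x : EuclideanSpace ℝ (Fin n)) :
      partialDeriv i (partialDeriv j u) x =
        fderiv ℝ (fderiv ℝ u) x (EuclideanSpace.single i 1) (EuclideanSpace.single j 1) := by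
    rw [partialDeriv_eq_fderiv h1 j, partialDeriv_eq_fderiv]
    · simp [fderiv_clm_apply (h3 x) (differentiableAt_const _)]
    · exact h3.clm_apply (differentiable_const _)
  ext x
  rw [key, key]
  exact (hu.contDiffAt (x := x)).isSymmSndFDerivAt (by simp) _ _

lemma contDiff_foldr_partialDeriv (l : List (Fin n)) {m : ℕ}
    (hu : ContDiff ℝ (l.length + m : ℕ) u) : ContDiff ℝ m (l.foldr partialDeriv u) := by
  induction l generalizing m with
  | nil => simpa using hu
  | cons j l ih =>
    refine contDiff_partialDeriv (ih ?_) j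
    rwa [List.length_cons, add_assoc, add_comm 1 m] at hu

lemma foldr_partialDeriv_perm {l l' : List (Fin n)} (hl : l.Perm l')
    (hu : ContDiff ℝ l.length u) : l.foldr partialDeriv u = l'.foldr partialDeriv u := by
  induction hl with
  | nil => rfl
  | cons j _ ih =>
    simp only [List.foldr_cons]
    rw [ih (hu.of_le (by norm_cast; simp))]
  | swap i j l => exact partialDeriv_comm (contDiff_foldr_partialDeriv (m := 2) l hu) _ _
  | trans h1 h2 ih1 ih2 => rw [ih1 hu, ih2 (by rwa [← h1.length_eq])]

lemma multiDeriv_eq_foldr (k : Fin n → ℕ) (u : EuclideanSpace ℝ (Fin n) → ℝ) :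
    multiDeriv k u =
      ((List.finRange n).flatMap fun j => List.replicate (k j) j).foldr partialDeriv u := by
  unfold multiDeriv
  induction List.finRange n with
  | nil => rfl
  | cons j l ih =>
    have (m : ℕ) (v : EuclideanSpace ℝ (Fin n) → ℝ) :
        (partialDeriv j)^[m] v = (List.replicate m j).foldr partialDeriv v := by
      induction m with
      | zero => rfl
      | succ m ihm => rw [Function.iterate_succ_apply', ihm]; rfl
    rw [List.foldr_cons, List.flatMap_cons, List.foldr_append, ← ih, this]

/-- Partial derivatives commute, so only the multiplicity of each coordinate in the list matters. -/
lemma foldr_partialDeriv_eq_multiDeriv (l : List (Fin n)) (hu : ContDiff ℝ l.length u) :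
    l.foldr partialDeriv u = multiDeriv (fun j => l.count j) u := by
  rw [multiDeriv_eq_foldr]
  refine foldr_partialDeriv_perm (List.perm_iff_count.2 fun i => ?_) hu
  rw [List.count_flatMap, ← List.ofFn_eq_map]
  simp [List.sum_ofFn, List.count_replicate]

lemma order_count (l : List (Fin n)) : order (fun j => l.count j) = l.length := by
  unfold order
  simpa using Multiset.sum_count_eq_card (s := Finset.univ) (m := (l : Multiset (Fin n)))
    (by simp)

lemma iteratedFDeriv_single_eq_foldr (l : List (Fin n)) (hu : ContDiff ℝ l.length u)
    (x : EuclideanSpace ℝ (Fin n)) :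
    iteratedFDeriv ℝ l.length u x (fun i => EuclideanSpace.single (l.get i) 1) =
      l.foldr partialDeriv u x := by
  induction l generalizing x with
  | nil => simp
  | cons j l ih =>
    have hl : ContDiff ℝ l.length u := hu.of_le (by norm_cast; simp)
    have hd : Differentiable ℝ (iteratedFDeriv ℝ l.length u) :=
      hu.differentiable_iteratedFDeriv (by norm_cast; simp)
    have h1 : ContDiff ℝ 1 (l.foldr partialDeriv u) := contDiff_foldr_partialDeriv (m := 1) l hu
    rw [List.foldr_cons, partialDeriv_eq_fderiv (h1.differentiable one_ne_zero)]
    have h2 : l.foldr partialDeriv u = fun y =>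
        iteratedFDeriv ℝ l.length u y (fun i => EuclideanSpace.single (l.get i) 1) :=
      funext fun y => (ih hl y).symm
    have h3 : HasFDerivAt (l.foldr partialDeriv u)
        ((ContinuousMultilinearMap.apply ℝ (fun _ : Fin l.length => EuclideanSpace ℝ (Fin n)) ℝ
          (fun i => EuclideanSpace.single (l.get i) 1)).comp
            (fderiv ℝ (iteratedFDeriv ℝ l.length u) x)) x := by
      rw [h2]
      exact (ContinuousMultilinearMap.apply ℝ (fun _ : Fin l.length => EuclideanSpace ℝ (Fin n)) ℝ
          (fun i => EuclideanSpace.single (l.get i) 1)).hasFDerivAt.comp x (hd x).hasFDerivAt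
    beta_reduce
    rw [h3.fderiv]
    exact iteratedFDeriv_succ_apply_left _

/-- A multilinear map is determined on tuples of basis vectors, where the iterated derivative is a
mixed partial. -/
lemma iteratedFDeriv_eq_zero_of_multiDeriv {a : ℕ} (hu : ContDiff ℝ a u)
    {x : EuclideanSpace ℝ (Fin n)} (h : ∀ k : Fin n → ℕ, order k = a → multiDeriv k u x = 0) :
    iteratedFDeriv ℝ a u x = 0 := by
  have key : (iteratedFDeriv ℝ a u x).toMultilinearMap = 0 := by
    refine Module.Basis.ext_multilinear
      (fun _ => (EuclideanSpace.basisFun (Fin n) ℝ).toBasis) fun v => ?_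
    obtain ⟨l, hl, hv⟩ : ∃ (l : List (Fin n)) (hl : l.length = a),
        ∀ i, v i = l.get (Fin.cast hl.symm i) := ⟨List.ofFn v, by simp, by simp⟩
    subst hl
    have h1 := iteratedFDeriv_single_eq_foldr l hu x
    rw [foldr_partialDeriv_eq_multiDeriv l hu, h _ (order_count l)] at h1
    simpa [hv] using h1
  ext v
  exact congrArg (fun f => f v) key

end MultiIndex

/-- The derivatives of `F` of order `a ≤ N` are bounded by `B ‖x‖ ^ (m - a)` away from `0`. -/
def DerivBound (N : ℕ) (m B : ℝ) (F : EuclideanSpace ℝ (Fin n) → ℝ) : Prop :=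
  ∀ a ≤ N, ∀ x ≠ 0, ‖iteratedFDeriv ℝ a F x‖ ≤ B * ‖x‖ ^ (m - a)

variable {N : ℕ} {m m' B B' : ℝ} {F H : EuclideanSpace ℝ (Fin n) → ℝ}

lemma DerivBound.abs_le (h : DerivBound N m B F) {x : EuclideanSpace ℝ (Fin n)} (hx : x ≠ 0) :
    |F x| ≤ B * ‖x‖ ^ m := by
  simpa using h 0 (Nat.zero_le _) x hx

/-- Leibniz rule: every term carries the same power `m + m' - a`, and the binomial coefficients sum
to `2 ^ a`. -/
lemma DerivBound.mul (hF : ContDiffOn ℝ N F {0}ᶜ) (hH : ContDiffOn ℝ N H {0}ᶜ)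
    (hB : 0 ≤ B) (h : DerivBound N m B F) (h' : DerivBound N m' B' H) :
    DerivBound N (m + m') (2 ^ N * (B * B')) (fun x => F x * H x) := by
  intro a ha x hx
  have ho : IsOpen ({0}ᶜ : Set (EuclideanSpace ℝ (Fin n))) := isOpen_compl_singleton
  have hx' : x ∈ ({0}ᶜ : Set (EuclideanSpace ℝ (Fin n))) := hx
  have hxp : 0 < ‖x‖ := norm_pos_iff.2 hx
  have hB' : 0 ≤ B' := by
    have := (abs_nonneg _).trans (h'.abs_le hx)
    exact nonneg_of_mul_nonneg_left this (by positivity)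
  have key := norm_iteratedFDerivWithin_mul_le hF hH ho.uniqueDiffOn hx' (n := a)
    (by exact_mod_cast ha)
  simp only [iteratedFDerivWithin_of_isOpen _ ho hx'] at key
  refine key.trans ?_
  calc _ ≤ ∑ i ∈ Finset.range (a + 1), (a.choose i : ℝ) * (B * B' * ‖x‖ ^ (m + m' - a)) := by
        refine Finset.sum_le_sum fun i hi => ?_
        have hi' : i ≤ a := by simpa [Nat.lt_succ_iff] using hi
        rw [mul_assoc]
        refine mul_le_mul_of_nonneg_left ?_ (by positivity)
        calc _ ≤ (B * ‖x‖ ^ (m - i)) * (B' * ‖x‖ ^ (m' - (a - i : ℕ))) := by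
              gcongr
              · exact h i (hi'.trans ha) x hx
              · exact h' (a - i) ((Nat.sub_le _ _).trans ha) x hx
          _ = B * B' * (‖x‖ ^ (m - i) * ‖x‖ ^ (m' - (a - i : ℕ))) := by ring
          _ = _ := by
              rw [← Real.rpow_add hxp, Nat.cast_sub hi']
              congr 2; ring
    _ = 2 ^ a * (B * B') * ‖x‖ ^ (m + m' - a) := by
        rw [← Finset.sum_mul, ← Nat.cast_sum, Nat.sum_range_choose]
        push_cast; ring
    _ ≤ _ := by
        gcongr
        norm_num

/-- The chain-rule factor `t ^ a` cancels against `(t‖x‖) ^ (m - a)`, leaving `t ^ m` for every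
order `a`. This is the source of the power of `h` in the remainder. -/
lemma DerivBound.comp_smul (hF : ContDiff ℝ N F) (h : DerivBound N m B F) {t : ℝ} (ht : 0 < t) :
    DerivBound N m (B * t ^ m) (fun x => F (t • x)) := by
  intro a ha x hx
  rw [iteratedFDeriv_comp_const_smul t (hF.of_le (by exact_mod_cast ha)), norm_smul, norm_pow,
    Real.norm_of_nonneg ht.le]
  calc _ ≤ t ^ a * (B * ‖t • x‖ ^ (m - a)) := by
        gcongr
        exact h a ha _ (smul_ne_zero ht.ne' hx)
    _ = _ := by
        rw [norm_smul, Real.norm_of_nonneg ht.le, Real.mul_rpow ht.le (norm_nonneg _),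
          Real.rpow_sub ht, Real.rpow_natCast]
        field_simp

/-- A function that is smooth and homogeneous off the origin. -/
lemma exists_derivBound_of_homogeneous {d : ℝ} (hF : ContDiffOn ℝ ∞ F {0}ᶜ)
    (hd : ∀ t : ℝ, 0 < t → ∀ x, x ≠ 0 → F (t • x) = t ^ d * F x) (N : ℕ) :
    ∃ B, 0 ≤ B ∧ DerivBound N d B F := by
  have ho : IsOpen ({0}ᶜ : Set (EuclideanSpace ℝ (Fin n))) := isOpen_compl_singleton
  have hsph (a : ℕ) : ∃ B, ∀ x ∈ Metric.sphere (0 : EuclideanSpace ℝ (Fin n)) 1,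
      ‖iteratedFDerivWithin ℝ a F {0}ᶜ x‖ ≤ B := by
    refine (isCompact_sphere _ _).exists_bound_of_continuousOn
      ((hF.continuousOn_iteratedFDerivWithin (by exact_mod_cast le_top) ho.uniqueDiffOn).mono ?_)
    intro x hx h0
    rw [Set.mem_singleton_iff] at h0
    simp [h0] at hx
  choose B hB using hsph
  refine ⟨∑ a ∈ Finset.range (N + 1), |B a|, by positivity, fun a ha x hx => ?_⟩
  have hxp : 0 < ‖x‖ := norm_pos_iff.2 hx
  set t := ‖x‖ with ht
  set y := t⁻¹ • x with hy
  have hy0 : y ≠ 0 := smul_ne_zero (inv_ne_zero hxp.ne') hx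
  have hty : t • y = x := by rw [hy, smul_inv_smul₀ hxp.ne']
  let L : EuclideanSpace ℝ (Fin n) →L[ℝ] EuclideanSpace ℝ (Fin n) :=
    t • ContinuousLinearMap.id ℝ _
  have hpre : L ⁻¹' {0}ᶜ = {0}ᶜ := by
    ext z; simp [L, hxp.ne']
  have h1 := L.iteratedFDerivWithin_comp_right hF ho.uniqueDiffOn
    (by rw [hpre]; exact ho.uniqueDiffOn) (x := y) (by simpa [L, hxp.ne'] using hy0)
    (i := a) (by exact_mod_cast le_top)
  rw [hpre] at h1
  -- By homogeneity, composing with the dilation is multiplication by `t ^ d`; comparing derivatives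
  -- at the unit vector `y` gives the bound at `x = t • y`.
  have h2 : iteratedFDerivWithin ℝ a (F ∘ L) {0}ᶜ y =
      iteratedFDerivWithin ℝ a (t ^ d • F) {0}ᶜ y := by
    refine iteratedFDerivWithin_congr (fun z hz => ?_) hy0 a
    simpa [L] using hd t hxp z hz
  rw [h2, iteratedFDerivWithin_const_smul_apply
    ((hF y hy0).of_le (by exact_mod_cast le_top)) ho.uniqueDiffOn hy0] at h1
  have h3 : L y = x := hty
  rw [h3] at h1
  have h4 : t ^ d • iteratedFDerivWithin ℝ a F {0}ᶜ y =
      t ^ a • iteratedFDerivWithin ℝ a F {0}ᶜ x := by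
    rw [h1]
    ext v
    simp [L, ContinuousMultilinearMap.map_smul_univ]
  rw [iteratedFDerivWithin_of_isOpen a ho hx] at h4
  have h5 := congrArg norm h4
  rw [norm_smul, norm_smul, Real.norm_of_nonneg (by positivity),
    Real.norm_of_nonneg (by positivity)] at h5
  have h6 : ‖iteratedFDeriv ℝ a F x‖ =
      ‖iteratedFDerivWithin ℝ a F {0}ᶜ y‖ * t ^ (d - a) := by
    rw [Real.rpow_sub hxp, Real.rpow_natCast]
    field_simp
    linarith
  rw [h6]
  gcongr
  refine (hB a y (by simp [hy, norm_smul, ← ht, abs_of_pos hxp, hxp.ne'])).trans ((le_abs_self _).trans ?_)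
  exact Finset.single_le_sum (f := fun a => |B a|) (fun _ _ => abs_nonneg _)
    (Finset.mem_range.2 (by omega))

/-- A compactly supported function whose derivatives of orders `1, …, P - 1` vanish at the origin
differs from its value there by `O(‖x‖ ^ P)`, with corresponding bounds for the derivatives. -/
lemma exists_derivBound_sub_const {g : EuclideanSpace ℝ (Fin n) → ℝ} (hg : ContDiff ℝ N g)
    (hgc : HasCompactSupport g) {P : ℕ} (hP : P ≤ N)
    (h0 : ∀ a, 1 ≤ a → a < P → iteratedFDeriv ℝ a g 0 = 0) :
    ∃ B, 0 ≤ B ∧ DerivBound N P B (fun x => g x - g 0) := by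
  set G : EuclideanSpace ℝ (Fin n) → ℝ := fun x => g x - g 0 with hG
  have hGc : ContDiff ℝ N G := hg.sub contDiff_const
  have hder (a : ℕ) (ha : a ≠ 0) (haN : a ≤ N) : iteratedFDeriv ℝ a G = iteratedFDeriv ℝ a g := by
    ext1 x
    have h1 : ContDiffAt ℝ a g x := (hg.of_le (by exact_mod_cast haN)).contDiffAt
    have := iteratedFDeriv_sub_apply h1 (contDiffAt_const (c := g 0))
    rw [iteratedFDeriv_const_of_ne ha] at this
    simpa [hG, Pi.sub_def] using this
  have hbdd (a : ℕ) (haN : a ≤ N) : ∃ C, ∀ x, ‖iteratedFDeriv ℝ a G x‖ ≤ C := by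
    by_cases ha : a = 0
    · subst ha
      obtain ⟨C, hC⟩ := hgc.exists_bound_of_continuous hg.continuous
      refine ⟨C + C, fun x => ?_⟩
      rw [norm_iteratedFDeriv_zero]
      exact (norm_sub_le _ _).trans (add_le_add (hC _) (hC _))
    · rw [hder a ha haN]
      exact (hgc.iteratedFDeriv a).exists_bound_of_continuous
        (hg.continuous_iteratedFDeriv (by exact_mod_cast haN))
  -- Descend from order `P`: each lower derivative vanishes at `0`, so the mean value inequality
  -- gains a factor `‖x‖`. Order `0` vanishes there because `g 0` was subtracted.
  have hlow (j : ℕ) (hj : j ≤ P) : ∃ C, ∀ x, ‖iteratedFDeriv ℝ (P - j) G x‖ ≤ C * ‖x‖ ^ j := by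
    induction j with
    | zero => simpa using hbdd P hP
    | succ j ih =>
      obtain ⟨C, hC⟩ := ih (by omega)
      refine ⟨C, fun x => ?_⟩
      have hz : iteratedFDeriv ℝ (P - (j + 1)) G 0 = 0 := by
        by_cases ha : P - (j + 1) = 0
        · rw [ha]; ext v; simp [hG]
        · rw [hder _ ha (by omega)]
          exact h0 _ (by omega) (by omega)
      have hC0 : 0 ≤ C * ‖x‖ ^ j := (norm_nonneg _).trans (hC x)
      have hCp : ∀ y ∈ Metric.closedBall (0 : EuclideanSpace ℝ (Fin n)) ‖x‖,
          ‖fderiv ℝ (iteratedFDeriv ℝ (P - (j + 1)) G) y‖ ≤ C * ‖x‖ ^ j := fun y hy => by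
        rw [norm_fderiv_iteratedFDeriv, show P - (j + 1) + 1 = P - j by omega]
        -- At `x = 0` nothing is known about the sign of `C`, but the ball is then a single point.
        by_cases hx : ‖x‖ = 0
        · have : y = x := by
            rw [hx] at hy
            rw [norm_eq_zero.1 hx]
            simpa using hy
          rw [this]; exact hC x
        · have hCn : 0 ≤ C := nonneg_of_mul_nonneg_left hC0 (by positivity)
          refine (hC y).trans ?_
          have : ‖y‖ ≤ ‖x‖ := by simpa using hy
          gcongr
      have := (convex_closedBall (0 : EuclideanSpace ℝ (Fin n)) ‖x‖).norm_image_sub_le_of_norm_fderiv_le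
        (𝕜 := ℝ) (fun z _ => (hGc.differentiable_iteratedFDeriv (m := P - (j + 1))
          (by norm_cast; omega)) z) hCp
        (x := 0) (y := x) (by simp) (by simp)
      rw [hz, sub_zero, sub_zero] at this
      rw [pow_succ, ← mul_assoc]
      exact this
  have hall (a : ℕ) : ∃ C, a ≤ N → ∀ x ≠ 0, ‖iteratedFDeriv ℝ a G x‖ ≤ C * ‖x‖ ^ ((P : ℝ) - a) := by
    by_cases haP : a ≤ P
    · obtain ⟨C, hC⟩ := hlow (P - a) (by omega)
      refine ⟨C, fun _ x _ => ?_⟩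
      have := hC x
      rwa [show P - (P - a) = a by omega, ← Real.rpow_natCast, Nat.cast_sub haP] at this
    · by_cases haN : a ≤ N
      · obtain ⟨C, hC⟩ := hbdd a haN
        obtain ⟨r, hr⟩ := hgc.isBounded.subset_closedBall (0 : EuclideanSpace ℝ (Fin n))
        have hr0 : ∀ x, r < ‖x‖ → iteratedFDeriv ℝ a G x = 0 := fun x hx => by
          rw [hder a (by omega) haN]
          by_contra h
          have := hr (tsupport_iteratedFDeriv_subset a (subset_tsupport _ h))
          simp at this
          linarith
        have hC0 : 0 ≤ C := (norm_nonneg _).trans (hC 0)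
        have hneg : (P : ℝ) - a ≤ 0 := by
          rw [sub_nonpos]; exact_mod_cast (not_le.1 haP).le
        -- Above order `P` the exponent is negative, so on the support the power of `‖x‖` is at
        -- least its value at radius `|r| + 1`.
        refine ⟨C * (|r| + 1) ^ ((a : ℝ) - P), fun _ x hx => ?_⟩
        have hxp : 0 < ‖x‖ := norm_pos_iff.2 hx
        by_cases hxr : r < ‖x‖
        · rw [hr0 x hxr, norm_zero]; positivity
        · have h1 : (|r| + 1) ^ ((P : ℝ) - a) ≤ ‖x‖ ^ ((P : ℝ) - a) :=
            Real.rpow_le_rpow_of_nonpos hxp (by linarith [le_abs_self r]) hneg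
          calc _ ≤ C * ((|r| + 1) ^ ((a : ℝ) - P) * (|r| + 1) ^ ((P : ℝ) - a)) := by
                rw [← Real.rpow_add (by positivity)]
                simpa using hC x
            _ ≤ _ := by rw [mul_assoc]; gcongr
      · exact ⟨0, fun h => absurd h haN⟩
  choose C hC using hall
  refine ⟨∑ a ∈ Finset.range (N + 1), |C a|, by positivity, fun a ha x hx => ?_⟩
  refine (hC a ha x hx).trans ?_
  gcongr
  exact (le_abs_self _).trans (Finset.single_le_sum (f := fun a => |C a|)
    (fun _ _ => abs_nonneg _) (Finset.mem_range.2 (by omega)))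

/-- Derivative bounds for a function vanishing near the origin control its cell defects. -/
lemma abs_cellDefect_iterate_le (hF : ContDiff ℝ N F) (hB : 0 ≤ B) (h : DerivBound N m B F)
    (hz : ∀ x, ‖x‖ < 1 → F x = 0) (hm : m ≤ N) (x : EuclideanSpace ℝ (Fin n)) :
    |cellDefect^[N] F x| ≤ B * (√n ^ N * (2 ^ (N - m) * (1 + N * √n) ^ (N - m))) *
      (1 + ‖x‖) ^ (-(N - m)) := by
  have h1 (z : EuclideanSpace ℝ (Fin n)) :
      ‖iteratedFDeriv ℝ N F z‖ ≤ B * 2 ^ (N - m) * (1 + ‖z‖) ^ (-(N - m)) := by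
    by_cases hz1 : ‖z‖ < 1
    · have : F =ᶠ[𝓝 z] fun _ => 0 := by
        filter_upwards [(isOpen_lt continuous_norm continuous_const).mem_nhds hz1] with y hy
        exact hz y hy
      rw [(this.iteratedFDeriv ℝ N).eq_of_nhds]
      simp only [iteratedFDeriv_fun_zero, Pi.zero_apply, norm_zero]
      positivity
    · have hz0 : z ≠ 0 := fun h0 => hz1 (by simp [h0])
      refine (h N le_rfl z hz0).trans ?_
      rw [mul_assoc]
      gcongr
      have hzp : 0 < ‖z‖ := norm_pos_iff.2 hz0
      calc ‖z‖ ^ (m - N) = 2 ^ (N - m) * (2 * ‖z‖) ^ (-(N - m)) := by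
            rw [Real.mul_rpow (by norm_num) hzp.le, ← mul_assoc, ← Real.rpow_add (by norm_num)]
            simp
        _ ≤ _ := by
            gcongr ?_ * ?_
            exact Real.rpow_le_rpow_of_nonpos (by positivity) (by linarith) (by linarith)
  have h2 := norm_cellDefect_iterate_le N hF (x := x)
    (B := B * 2 ^ (N - m) * ((1 + N * √n) ^ (N - m) * (1 + ‖x‖) ^ (-(N - m)))) fun z hz' => by
      refine (h1 z).trans ?_
      gcongr ?_ * ?_
      have hR : 0 < 1 + N * √n := by positivity
      -- Within distance `N√n` of `x`, `1 + ‖x‖ ≤ (1 + N√n)(1 + ‖z‖)`.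
      calc (1 + ‖z‖) ^ (-(N - m)) =
            (1 + N * √n) ^ (N - m) * ((1 + N * √n) * (1 + ‖z‖)) ^ (-(N - m)) := by
              rw [Real.mul_rpow hR.le (by positivity), ← mul_assoc, ← Real.rpow_add hR]
              simp
        _ ≤ _ := by
            gcongr ?_ * ?_
            refine Real.rpow_le_rpow_of_nonpos (by positivity) ?_ (by linarith)
            rw [Metric.mem_closedBall, dist_eq_norm] at hz'
            have := norm_sub_norm_le x z
            rw [norm_sub_rev] at this
            nlinarith [norm_nonneg z, mul_nonneg (by positivity : 0 ≤ N * √n) (norm_nonneg z)]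
  rw [Real.norm_eq_abs] at h2
  exact h2.trans_eq (by ring)

end DerivBounds

/-! ### Splitting the punctured error into near and far parts -/

section ErrorExpansion

variable {n : ℕ}

/-- A smooth cutoff equal to `1` on the unit ball and supported in the ball of radius `2`. -/
def cutoff (n : ℕ) : ContDiffBump (0 : EuclideanSpace ℝ (Fin n)) where
  rIn := 1
  rOut := 2
  rIn_pos := one_pos
  rIn_lt_rOut := one_lt_two

lemma cutoff_eq_one {x : EuclideanSpace ℝ (Fin n)} (hx : ‖x‖ < 1) : cutoff n x = 1 :=
  (cutoff n).one_of_mem_closedBall (by simpa [cutoff] using hx.le)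

/-- The error of the punctured trapezoidal rule on the unit grid. -/
def puncturedError (f : EuclideanSpace ℝ (Fin n) → ℝ) : ℝ :=
  (∫ x, f x) - ∑' β : {β : Fin n → ℤ // β ≠ 0}, f (gridPoint 1 β.1)

/-- The sum of the iterated cell defects of `f` with the singularity at the origin cut off. -/
def farDefect (N : ℕ) (f : EuclideanSpace ℝ (Fin n) → ℝ) : ℝ :=
  ∑' β : Fin n → ℤ, cellDefect^[N] (fun x => (1 - cutoff n x) * f x) (gridPoint 1 β)

lemma gridPoint_eq_smul (h : ℝ) (β : Fin n → ℤ) : gridPoint h β = h • gridPoint 1 β := by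
  ext j; simp [gridPoint, mul_comm]

lemma gridPoint_zero : gridPoint (n := n) 1 0 = 0 := by
  ext j; simp [gridPoint]

lemma gridPoint_ne_zero {β : Fin n → ℤ} (hβ : β ≠ 0) : gridPoint 1 β ≠ 0 := fun h =>
  hβ (funext fun j => by
    have := congrArg (fun x => x.ofLp j) h
    simpa [gridPoint] using this)

lemma ae_ne_zero (hn : 0 < n) : ∀ᵐ x : EuclideanSpace ℝ (Fin n), x ≠ 0 := by
  have : Nonempty (Fin n) := ⟨⟨0, hn⟩⟩
  have : Nontrivial (EuclideanSpace ℝ (Fin n)) :=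
    ⟨EuclideanSpace.single ⟨0, hn⟩ 1, 0, by simp⟩
  exact (measure_singleton (0 : EuclideanSpace ℝ (Fin n)) : volume _ = 0) |> compl_mem_ae_iff.2

lemma aestronglyMeasurable_of_continuousOn_compl_zero (hn : 0 < n)
    {f : EuclideanSpace ℝ (Fin n) → ℝ} (hf : ContinuousOn f {0}ᶜ) :
    AEStronglyMeasurable f := by
  have h1 := hf.aestronglyMeasurable (μ := volume) (measurableSet_singleton _).compl
  have h2 : volume.restrict ({0}ᶜ : Set (EuclideanSpace ℝ (Fin n))) = volume :=
    Measure.restrict_eq_self_of_ae_mem (ae_ne_zero hn)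
  rwa [h2] at h1

/-- In polar coordinates the radial integrand is `y ^ (n - 1 + m)`, integrable at `0` because its
exponent exceeds `-1`. -/
lemma integrable_mul_norm_rpow (hn : 0 < n) {m : ℝ} (hm : -(n : ℝ) < m)
    {u : EuclideanSpace ℝ (Fin n) → ℝ} (hu : Continuous u) (huc : HasCompactSupport u) :
    Integrable fun x => u x * ‖x‖ ^ m := by
  obtain ⟨r, hr⟩ := huc.isBounded.subset_closedBall (0 : EuclideanSpace ℝ (Fin n))
  obtain ⟨C, hC⟩ := huc.exists_bound_of_continuous hu
  have : Nontrivial (EuclideanSpace ℝ (Fin n)) :=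
    ⟨EuclideanSpace.single ⟨0, hn⟩ 1, 0, by simp⟩
  have h1 : Integrable fun x : EuclideanSpace ℝ (Fin n) =>
      (Set.Iic r).indicator (fun y : ℝ => y ^ m) ‖x‖ := by
    rw [integrable_fun_norm_addHaar]
    have h2 : IntegrableOn (fun y : ℝ => y ^ (n - 1 + m)) (Set.Ioc 0 |r|) := by
      have := intervalIntegral.intervalIntegrable_rpow' (a := 0) (b := |r|) (r := n - 1 + m)
        (by linarith)
      rwa [intervalIntegrable_iff_integrableOn_Ioc_of_le (abs_nonneg r)] at this
    have h3 : IntegrableOn (fun y : ℝ => y ^ (n - 1 + m)) (Set.Iic r ∩ Set.Ioi 0) :=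
      h2.mono_set fun y hy => ⟨hy.2, le_trans hy.1 (le_abs_self r)⟩
    rw [IntegrableOn, ← Measure.restrict_restrict measurableSet_Iic] at h3
    have h4 : IntegrableOn ((Set.Iic r).indicator fun y : ℝ => y ^ (n - 1 + m)) (Set.Ioi 0) :=
      (integrable_indicator_iff measurableSet_Iic).2 h3
    refine h4.congr_fun (fun y hy => ?_) measurableSet_Ioi
    by_cases hyr : y ∈ Set.Iic r
    · simp only [Set.indicator_of_mem hyr, finrank_euclideanSpace, Fintype.card_fin, smul_eq_mul]
      rw [Real.rpow_add hy, ← Real.rpow_natCast, Nat.cast_sub (by omega), Nat.cast_one]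
    · simp only [Set.indicator_of_notMem hyr, smul_zero]
  have hmeas : AEStronglyMeasurable fun x : EuclideanSpace ℝ (Fin n) => u x * ‖x‖ ^ m :=
    aestronglyMeasurable_of_continuousOn_compl_zero hn (hu.continuousOn.mul
      (continuous_norm.continuousOn.rpow_const fun x hx => Or.inl (norm_ne_zero_iff.2 hx)))
  refine (h1.const_mul C).mono' hmeas (Eventually.of_forall fun x => ?_)
  have hC0 := (norm_nonneg _).trans (hC x)
  by_cases hx : ‖x‖ ∈ Set.Iic r
  · rw [Set.indicator_of_mem hx, norm_mul, Real.norm_of_nonneg (r := ‖x‖ ^ m) (by positivity)]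
    gcongr
    exact hC x
  · have : u x = 0 := by
      by_contra h
      exact hx (by simpa using hr (subset_tsupport _ h))
    simp [this, Set.indicator_of_notMem hx]

variable {m B : ℝ} {f : EuclideanSpace ℝ (Fin n) → ℝ}

lemma integrable_mul_of_abs_le (hn : 0 < n) (hm : -(n : ℝ) < m) (hf : ContinuousOn f {0}ᶜ)
    (hfB : ∀ x ≠ 0, |f x| ≤ B * ‖x‖ ^ m) {u : EuclideanSpace ℝ (Fin n) → ℝ} (hu : Continuous u)
    (huc : HasCompactSupport u) : Integrable fun x => u x * f x := by
  refine ((integrable_mul_norm_rpow hn hm hu.abs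
    (huc.comp_left (g := fun y : ℝ => |y|) abs_zero)).const_mul B).mono'
    (aestronglyMeasurable_of_continuousOn_compl_zero hn (hu.continuousOn.mul hf)) ?_
  filter_upwards [ae_ne_zero hn] with x hx
  rw [norm_mul, Real.norm_eq_abs, Real.norm_eq_abs]
  calc |u x| * |f x| ≤ |u x| * (B * ‖x‖ ^ m) := by gcongr; exact hfB x hx
    _ = _ := by ring

lemma summable_punctured {F : EuclideanSpace ℝ (Fin n) → ℝ} (hF : HasCompactSupport F) :
    Summable fun β : {β : Fin n → ℤ // β ≠ 0} => F (gridPoint 1 β.1) :=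
  (summable_of_hasFiniteSupport (finite_support_comp_gridPoint hF)).subtype {β | β ≠ 0}

lemma puncturedError_add {F H : EuclideanSpace ℝ (Fin n) → ℝ} (hF : Integrable F)
    (hH : Integrable H) (hFc : HasCompactSupport F) (hHc : HasCompactSupport H) :
    puncturedError (fun x => F x + H x) = puncturedError F + puncturedError H := by
  unfold puncturedError
  rw [integral_add hF hH, (summable_punctured hFc).tsum_add (summable_punctured hHc)]
  ring

lemma puncturedError_const_mul (a : ℝ) (F : EuclideanSpace ℝ (Fin n) → ℝ) :
    puncturedError (fun x => a * F x) = a * puncturedError F := by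
  unfold puncturedError
  rw [integral_const_mul, tsum_mul_left]
  ring

/-- `K` is the integral plus the punctured grid sum of `χ‖x‖ ^ m`, hence serves all `f` at once. -/
lemma exists_abs_puncturedError_cutoff_le (hn : 0 < n) (hm : -(n : ℝ) < m) :
    ∃ K, ∀ (B : ℝ) (f : EuclideanSpace ℝ (Fin n) → ℝ), (∀ x ≠ 0, |f x| ≤ B * ‖x‖ ^ m) →
      |puncturedError (fun x => cutoff n x * f x)| ≤ B * K := by
  have hs := summable_punctured (n := n) (F := fun x => cutoff n x * ‖x‖ ^ m)
    ((cutoff n).hasCompactSupport.mul_right)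
  refine ⟨(∫ x, cutoff n x * ‖x‖ ^ m) +
    ∑' β : {β : Fin n → ℤ // β ≠ 0}, cutoff n (gridPoint 1 β.1) * ‖gridPoint 1 β.1‖ ^ m,
    fun B f hf => ?_⟩
  have hb : ∀ x ≠ 0, ‖cutoff n x * f x‖ ≤ B * (cutoff n x * ‖x‖ ^ m) := fun x hx => by
    rw [norm_mul, Real.norm_of_nonneg (cutoff n).nonneg, Real.norm_eq_abs]
    calc cutoff n x * |f x| ≤ cutoff n x * (B * ‖x‖ ^ m) :=
          mul_le_mul_of_nonneg_left (hf x hx) (cutoff n).nonneg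
      _ = _ := by ring
  have h1 : ‖∫ x, cutoff n x * f x‖ ≤ B * ∫ x, cutoff n x * ‖x‖ ^ m := by
    rw [← integral_const_mul]
    exact norm_integral_le_of_norm_le ((integrable_mul_norm_rpow hn hm
      (cutoff n).continuous (cutoff n).hasCompactSupport).const_mul B)
      ((ae_ne_zero hn).mono hb)
  have h2 := tsum_of_norm_bounded (hs.hasSum.mul_left B)
    fun β : {β : Fin n → ℤ // β ≠ 0} => hb _ (gridPoint_ne_zero β.2)
  rw [mul_add]
  exact (norm_sub_le _ _).trans (add_le_add h1 h2)

lemma contDiff_one_sub_cutoff_mul {N : ℕ} (hf : ContDiffOn ℝ N f {0}ᶜ) :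
    ContDiff ℝ N fun x => (1 - cutoff n x) * f x := by
  refine contDiff_iff_contDiffAt.2 fun x => ?_
  by_cases hx : x = 0
  · have : (fun x => (1 - cutoff n x) * f x) =ᶠ[𝓝 x] fun _ => 0 := by
      filter_upwards [(isOpen_lt continuous_norm continuous_const).mem_nhds
        (show ‖x‖ < 1 by simp [hx])] with y hy
      rw [cutoff_eq_one hy]; simp
    exact contDiffAt_const.congr_of_eventuallyEq this
  · exact ((contDiff_const.sub (cutoff n).contDiff).contDiffAt).mul
      (hf.contDiffAt (isOpen_compl_singleton.mem_nhds hx))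

lemma exists_derivBound_one_sub_cutoff (N : ℕ) :
    ∃ B, 0 ≤ B ∧ DerivBound N 0 B (fun x : EuclideanSpace ℝ (Fin n) => 1 - cutoff n x) := by
  obtain ⟨B, hB, h⟩ := exists_derivBound_sub_const (N := N) (P := 0) (cutoff n).contDiff
    (cutoff n).hasCompactSupport (Nat.zero_le N) (fun a _ h => absurd h (Nat.not_lt_zero a))
  refine ⟨B, hB, fun a ha x hx => ?_⟩
  have h1 : (fun x : EuclideanSpace ℝ (Fin n) => 1 - cutoff n x) =
      -fun x => cutoff n x - cutoff n 0 := by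
    ext x
    rw [cutoff_eq_one (show ‖(0 : EuclideanSpace ℝ (Fin n))‖ < 1 by simp)]
    simp
  rw [h1, iteratedFDeriv_neg, Pi.neg_apply, norm_neg]
  simpa using h a ha x hx

/-- The defects decay like `(1 + ‖x‖) ^ (m - N)`, summable over the grid exactly because `N - m >
n`. No support condition on `f` is needed, so this applies to the kernel itself. -/
lemma exists_farDefect_bound {N : ℕ} (hm : m + n < N) :
    ∃ K, ∀ (B : ℝ) (f : EuclideanSpace ℝ (Fin n) → ℝ), 0 ≤ B → ContDiffOn ℝ N f {0}ᶜ →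
      DerivBound N m B f →
      (Summable fun β : Fin n → ℤ =>
        cellDefect^[N] (fun x => (1 - cutoff n x) * f x) (gridPoint 1 β)) ∧
      |farDefect N f| ≤ B * K := by
  obtain ⟨B₁, hB₁, h₁⟩ := exists_derivBound_one_sub_cutoff (n := n) N
  have hsum := summable_one_add_norm_gridPoint (n := n) (a := N - m) (by linarith)
  refine ⟨2 ^ N * B₁ * (√n ^ N * (2 ^ (N - m) * (1 + N * √n) ^ (N - m))) *
    ∑' β : Fin n → ℤ, (1 + ‖gridPoint 1 β‖) ^ (-(N - m)), fun B f hB hf h => ?_⟩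
  have h2 := h₁.mul (contDiff_const.sub (cutoff n).contDiff).contDiffOn hf hB₁ h
  rw [zero_add] at h2
  have h3 (β : Fin n → ℤ) := abs_cellDefect_iterate_le (contDiff_one_sub_cutoff_mul hf)
    (by positivity) h2 (fun x hx => by rw [cutoff_eq_one hx]; simp)
    (by linarith [Nat.cast_nonneg (α := ℝ) n]) (gridPoint 1 β)
  have h4 := hsum.mul_left
    (2 ^ N * (B₁ * B) * (√n ^ N * (2 ^ (N - m) * (1 + N * √n) ^ (N - m))))
  refine ⟨Summable.of_norm_bounded h4 h3, ?_⟩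
  have h5 := tsum_of_norm_bounded h4.hasSum fun β => (Real.norm_eq_abs _).trans_le (h3 β)
  rw [tsum_mul_left] at h5
  exact h5.trans_eq (by ring)

/-- Error representation: the integrand is split by the cutoff. -/
lemma puncturedError_eq_sub_farDefect {N : ℕ} (hN : 0 < N)
    (hf : ContDiffOn ℝ N f {0}ᶜ) (hfc : HasCompactSupport f) (hfi : Integrable f) :
    puncturedError f = puncturedError (fun x => cutoff n x * f x) - farDefect N f := by
  have hsm := contDiff_one_sub_cutoff_mul hf
  have hc1 : HasCompactSupport fun x => cutoff n x * f x := hfc.mul_left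
  have hc2 : HasCompactSupport fun x => (1 - cutoff n x) * f x := hfc.mul_left
  have hi2 : Integrable fun x => (1 - cutoff n x) * f x :=
    hsm.continuous.integrable_of_hasCompactSupport hc2
  have hi1 : Integrable fun x => cutoff n x * f x := by
    refine (hfi.sub hi2).congr (Eventually.of_forall fun x => ?_)
    simp only [Pi.sub_apply]; ring
  have h1 := puncturedError_add hi1 hi2 hc1 hc2
  have h2 : puncturedError (fun x => (1 - cutoff n x) * f x) = -farDefect N f := by
    -- The grid sum here includes the origin, harmlessly: the factor `1 - χ` vanishes there.
    have h3 := integral_sub_tsum_gridPoint hsm.continuous hc2 (N - 1)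
    rw [Nat.sub_add_cancel hN] at h3
    rw [farDefect, ← h3, puncturedError]
    congr 1
    refine tsum_subtype_eq_of_support_subset
      (f := fun β : Fin n → ℤ => (1 - cutoff n (gridPoint 1 β)) * f (gridPoint 1 β))
      (s := {β | β ≠ 0}) fun β hβ h0 => hβ ?_
    rw [h0]
    beta_reduce
    rw [gridPoint_zero, cutoff_eq_one (show ‖(0 : EuclideanSpace ℝ (Fin n))‖ < 1 by simp)]
    simp
  rw [sub_eq_add_neg, ← h2, ← h1]
  congr 1
  ext x; ring

/-! ### Error expansion for homogeneous kernels -/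

section Homogeneous

variable {d : ℝ} {σ : EuclideanSpace ℝ (Fin n) → ℝ}

/-- The constant in the leading error term for a homogeneous kernel `σ`, computed with `N`-fold
cell defects. -/
def errorConst (N : ℕ) (σ : EuclideanSpace ℝ (Fin n) → ℝ) : ℝ :=
  puncturedError (fun x => cutoff n x * σ x) - farDefect N σ

lemma exists_abs_puncturedError_sub_le (hn : 0 < n) (hσ : ContDiffOn ℝ ∞ σ {0}ᶜ)
    (hd : ∀ t : ℝ, 0 < t → ∀ x, x ≠ 0 → σ (t • x) = t ^ d * σ x) (hdn : -(n : ℝ) < d)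
    {N P : ℕ} (hP : P + d + n < N) {g : EuclideanSpace ℝ (Fin n) → ℝ} (hg : ContDiff ℝ N g)
    (hgc : HasCompactSupport g) (h0 : ∀ a, 1 ≤ a → a < P → iteratedFDeriv ℝ a g 0 = 0) :
    ∃ C, ∀ t : ℝ, 0 < t →
      |puncturedError (fun x => g (t • x) * σ x) - g 0 * errorConst N σ| ≤ C * t ^ P := by
  have hPN : P < N := by
    have : (P : ℝ) < N := by linarith
    exact_mod_cast this
  obtain ⟨B₁, hB₁, h₁⟩ := exists_derivBound_of_homogeneous hσ hd N
  obtain ⟨B₂, hB₂, h₂⟩ := exists_derivBound_sub_const hg hgc hPN.le h0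
  obtain ⟨K₁, hK₁⟩ := exists_abs_puncturedError_cutoff_le (m := P + d) hn
    (by linarith [Nat.cast_nonneg (α := ℝ) P])
  obtain ⟨K₂, hK₂⟩ := exists_farDefect_bound (n := n) (N := N) (m := P + d) (by linarith)
  obtain ⟨K₃, hK₃⟩ := exists_farDefect_bound (n := n) (N := N) (m := d)
    (by linarith [Nat.cast_nonneg (α := ℝ) P])
  have hσN : ContDiffOn ℝ N σ {0}ᶜ := hσ.of_le (by exact_mod_cast le_top)
  refine ⟨2 ^ N * (B₂ * B₁) * K₁ + 2 ^ N * (B₂ * B₁) * K₂, fun t ht => ?_⟩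
  have hgt : ContDiff ℝ N fun x => g (t • x) := hg.comp (contDiff_const_smul t)
  have hgtc : HasCompactSupport fun x => g (t • x) := hgc.comp_smul ht.ne'
  set D : EuclideanSpace ℝ (Fin n) → ℝ := fun x => (g (t • x) - g 0) * σ x with hD
  have hDc : ContDiffOn ℝ N D {0}ᶜ := (hgt.sub contDiff_const).contDiffOn.mul hσN
  -- Dilating `g - g 0`, which vanishes to order `P`, puts `t ^ P` into the constant.
  have hDb : DerivBound N (P + d) (2 ^ N * (B₂ * t ^ (P : ℝ) * B₁)) D :=
    (h₂.comp_smul (hg.sub contDiff_const) ht).mul (hgt.sub contDiff_const).contDiffOn hσN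
      (by positivity) h₁
  have hint : Integrable fun x => g (t • x) * σ x :=
    integrable_mul_of_abs_le hn hdn hσN.continuousOn (fun x hx => h₁.abs_le hx) hgt.continuous hgtc
  have hψ : HasCompactSupport (cutoff n) := (cutoff n).hasCompactSupport
  have hnear : puncturedError (fun x => cutoff n x * (g (t • x) * σ x)) =
      g 0 * puncturedError (fun x => cutoff n x * σ x) +
        puncturedError (fun x => cutoff n x * D x) := by
    rw [← puncturedError_const_mul, ← puncturedError_add]
    · congr 1; ext x; simp only [hD]; ring
    · exact (integrable_mul_of_abs_le hn hdn hσN.continuousOn (fun x hx => h₁.abs_le hx)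
        (cutoff n).continuous hψ).const_mul _
    · exact integrable_mul_of_abs_le hn (by linarith [Nat.cast_nonneg (α := ℝ) P])
        hDc.continuousOn (fun x hx => hDb.abs_le hx) (cutoff n).continuous hψ
    · exact hψ.mul_right.mul_left
    · exact hψ.mul_right
  obtain ⟨hs₃, -⟩ := hK₃ B₁ σ hB₁ hσN h₁
  obtain ⟨hs₂, hb₂⟩ := hK₂ _ D (by positivity) hDc hDb
  have hfar : farDefect N (fun x => g (t • x) * σ x) = g 0 * farDefect N σ + farDefect N D := by
    unfold farDefect
    rw [← tsum_mul_left, ← (hs₃.mul_left (g 0)).tsum_add hs₂]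
    congr 1
    ext β
    have : (fun x => (1 - cutoff n x) * (g (t • x) * σ x)) =
        (g 0 • fun x => (1 - cutoff n x) * σ x) + fun x => (1 - cutoff n x) * D x := by
      ext x; simp only [hD, Pi.add_apply, Pi.smul_apply, smul_eq_mul]; ring
    rw [this, cellDefect_iterate_add ((contDiff_one_sub_cutoff_mul hσN).continuous.const_smul _)
      (contDiff_one_sub_cutoff_mul hDc).continuous, cellDefect_iterate_smul]
    rfl
  have hb₁ := hK₁ _ D fun x hx => hDb.abs_le hx
  rw [puncturedError_eq_sub_farDefect (by omega) (hgt.contDiffOn.mul hσN) hgtc.mul_right hint,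
    hnear, hfar, errorConst]
  have h3 := abs_sub (puncturedError fun x => cutoff n x * D x) (farDefect N D)
  rw [Real.rpow_natCast] at hb₁ hb₂
  calc _ = |puncturedError (fun x => cutoff n x * D x) - farDefect N D| := by congr 1; ring
    _ ≤ _ := h3
    _ ≤ _ := add_le_add hb₁ hb₂
    _ = _ := by ring

/-- Taking `g = χ`, whose value at `0` is `1`, and `P = 1`, where no derivative need vanish,
exhibits both constants as the limit of one expression free of `N`. -/
lemma errorConst_congr (hn : 0 < n) (hσ : ContDiffOn ℝ ∞ σ {0}ᶜ)
    (hd : ∀ t : ℝ, 0 < t → ∀ x, x ≠ 0 → σ (t • x) = t ^ d * σ x) (hdn : -(n : ℝ) < d)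
    {N N' : ℕ} (hN : 1 + d + n < N) (hN' : 1 + d + n < N') :
    errorConst N σ = errorConst N' σ := by
  have key (M : ℕ) (hM : 1 + d + n < M) : Tendsto (fun t : ℝ =>
      puncturedError (fun x => cutoff n (t • x) * σ x)) (𝓝[>] 0) (𝓝 (errorConst M σ)) := by
    obtain ⟨C, hC⟩ := exists_abs_puncturedError_sub_le hn hσ hd hdn (P := 1) (by simpa using hM)
      (cutoff n).contDiff (cutoff n).hasCompactSupport fun a h1 h2 => absurd h1 (by omega)
    rw [cutoff_eq_one (show ‖(0 : EuclideanSpace ℝ (Fin n))‖ < 1 by simp)] at hC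
    rw [tendsto_iff_norm_sub_tendsto_zero]
    refine squeeze_zero' (g := fun t => C * t ^ 1) (Eventually.of_forall fun t => norm_nonneg _)
      (eventually_mem_nhdsWithin.mono fun t ht => by simpa using hC t ht) ?_
    have : Tendsto (fun t : ℝ => C * t ^ 1) (𝓝 0) (𝓝 (C * 0 ^ 1)) :=
      (by fun_prop : Continuous fun t : ℝ => C * t ^ 1).tendsto 0
    simpa using this.mono_left nhdsWithin_le_nhds
  exact tendsto_nhds_unique (key N hN) (key N' hN')

/-- Both the volume element and the weight give `h ^ n`, and homogeneity gives `h ^ d`. -/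
lemma integral_sub_puncturedTrapezoid (hn : 0 < n)
    (hd : ∀ t : ℝ, 0 < t → ∀ x, x ≠ 0 → σ (t • x) = t ^ d * σ x)
    (g : EuclideanSpace ℝ (Fin n) → ℝ) {h : ℝ} (hh : 0 < h) :
    (∫ x, g x * σ x) - puncturedTrapezoid h (fun x => g x * σ x) =
      h ^ (n + d) * puncturedError (fun x => g (h • x) * σ x) := by
  have h1 : ∫ x, g x * σ x = h ^ n * (h ^ d * ∫ x, g (h • x) * σ x) := by
    have h2 := Measure.integral_comp_smul_of_nonneg
      (volume : Measure (EuclideanSpace ℝ (Fin n))) (fun x => g x * σ x) h (hR := hh.le)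
    have h3 : ∫ x, g (h • x) * σ (h • x) = h ^ d * ∫ x, g (h • x) * σ x := by
      rw [← integral_const_mul]
      refine integral_congr_ae ((ae_ne_zero hn).mono fun x hx => ?_)
      simp only [hd h hh x hx]; ring
    rw [← h3, h2]
    simp only [finrank_euclideanSpace, Fintype.card_fin, smul_eq_mul]
    field_simp
  have h4 : ∑' β : {β : Fin n → ℤ // β ≠ 0}, g (gridPoint h β.1) * σ (gridPoint h β.1) =
      h ^ d * ∑' β : {β : Fin n → ℤ // β ≠ 0}, g (h • gridPoint 1 β.1) * σ (gridPoint 1 β.1) := by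
    rw [← tsum_mul_left]
    congr 1
    ext β
    rw [gridPoint_eq_smul h, hd h hh _ (gridPoint_ne_zero β.2)]
    ring
  rw [puncturedTrapezoid, puncturedError, h1, h4, Real.rpow_add hh, Real.rpow_natCast]
  ring

/-- The error expansion of the punctured trapezoidal rule for a homogeneous kernel. -/
theorem exists_errorConst (hn : 0 < n) (hσ : ContDiffOn ℝ ∞ σ {0}ᶜ)
    (hd : ∀ t : ℝ, 0 < t → ∀ x, x ≠ 0 → σ (t • x) = t ^ d * σ x) (hdn : -(n : ℝ) < d) :
    ∃ c : ℝ, ∀ (p N : ℕ) (g : EuclideanSpace ℝ (Fin n) → ℝ), (p : ℝ) + 1 + d + n < N →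
      ContDiff ℝ N g → HasCompactSupport g →
      (∀ k : Fin n → ℕ, 1 ≤ order k → order k ≤ p → multiDeriv k g 0 = 0) →
      Integrable (fun x => g x * σ x) ∧
      ∃ C : ℝ, ∀ h : ℝ, 0 < h →
        |(∫ x, g x * σ x) - puncturedTrapezoid h (fun x => g x * σ x)
            - g 0 * h ^ (n + d) * c| ≤ C * h ^ ((p : ℝ) + 1 + d + n) := by
  -- `N₀` is chosen before `p`, `N` and `g`, so the constant depends on `σ` alone.
  obtain ⟨N₀, hN₀⟩ := exists_nat_gt (1 + d + n)
  refine ⟨errorConst N₀ σ, fun p N g hN hg hgc h0 => ?_⟩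
  have hp0 : (0 : ℝ) ≤ p := Nat.cast_nonneg p
  obtain ⟨B, -, hB⟩ := exists_derivBound_of_homogeneous hσ hd N
  refine ⟨integrable_mul_of_abs_le hn hdn hσ.continuousOn (fun x hx => hB.abs_le hx)
    hg.continuous hgc, ?_⟩
  have hpN : p < N := by
    have : (p : ℝ) < N := by linarith
    exact_mod_cast this
  obtain ⟨C, hC⟩ := exists_abs_puncturedError_sub_le hn hσ hd hdn (P := p + 1)
    (by push_cast; exact hN) hg hgc fun a h1 h2 =>
      iteratedFDeriv_eq_zero_of_multiDeriv (hg.of_le (by norm_cast; omega))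
        fun k hk => h0 k (by omega) (by omega)
  refine ⟨C, fun h hh => ?_⟩
  rw [integral_sub_puncturedTrapezoid hn hd g hh,
    errorConst_congr hn hσ hd hdn hN₀ (by linarith : 1 + d + n < N)]
  calc _ = |h ^ (n + d) * (puncturedError (fun x => g (h • x) * σ x) - g 0 * errorConst N σ)| := by
        congr 1; ring
    _ ≤ h ^ (n + d) * (C * h ^ (p + 1)) := by
        rw [abs_mul, abs_of_pos (by positivity : 0 < h ^ (n + d))]
        gcongr
        exact hC h hh
    _ = C * (h ^ (((p + 1 : ℕ) : ℝ)) * h ^ (n + d)) := by rw [Real.rpow_natCast]; ring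
    _ = _ := by
        rw [← Real.rpow_add hh]
        congr 2; push_cast; ring

end Homogeneous

/-! ### The kernel times a monomial -/

lemma contDiff_monomial (ξ : Fin n → ℕ) : ContDiff ℝ ∞ (monomial ξ) := by
  unfold monomial
  fun_prop

lemma monomial_smul (ξ : Fin n → ℕ) (t : ℝ) (x : EuclideanSpace ℝ (Fin n)) :
    monomial ξ (t • x) = t ^ order ξ * monomial ξ x := by
  simp [monomial, order, mul_pow, Finset.prod_mul_distrib, Finset.prod_pow_eq_pow_sum]

lemma IsWeaklySingularKernel.map_smul {δ : ℝ} {κ : ℕ} {s : EuclideanSpace ℝ (Fin n) → ℝ}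
    (hs : IsWeaklySingularKernel n δ κ s) {t : ℝ} (ht : 0 < t) {x : EuclideanSpace ℝ (Fin n)}
    (hx : x ≠ 0) : s (t • x) = t ^ (δ - n) * s x := by
  obtain ⟨ρ, -, -, hρ⟩ := hs.dilation
  rw [hρ _ (smul_ne_zero ht.ne' hx), hρ x hx, norm_smul, Real.norm_of_nonneg ht.le,
    Real.mul_rpow ht.le (norm_nonneg _), smul_smul, mul_inv_rev, mul_assoc,
    inv_mul_cancel_right₀ ht.ne']

end ErrorExpansion

end PuncturedTrapezoid

end

open PuncturedTrapezoid in
theorem theorem3p2 (n : ℕ) (δ : ℝ) (κ : ℕ) (s : EuclideanSpace ℝ (Fin n) → ℝ)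
    (hs : IsWeaklySingularKernel n δ κ s) (ξ : Fin n → ℕ) :
    ∃ c : ℝ, ∀ (p N : ℕ) (g : EuclideanSpace ℝ (Fin n) → ℝ),
      max ((p : ℝ) + 1 + δ + order ξ) (n : ℝ) < (N : ℝ) →
      ContDiff ℝ N g → HasCompactSupport g →
      (∀ k : Fin n → ℕ, 1 ≤ order k → order k ≤ p → multiDeriv k g 0 = 0) →
      Integrable (fun x => g x * s x * monomial ξ x) ∧
      ∃ C : ℝ, ∀ h : ℝ, 0 < h →
        |(∫ x, g x * s x * monomial ξ x)
            - puncturedTrapezoid h (fun x => g x * s x * monomial ξ x)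
            - g 0 * h ^ ((order ξ : ℝ) + δ) * c|
          ≤ C * h ^ ((p : ℝ) + 1 + δ + order ξ) := by
  have hn : 0 < n := by
    have : (0 : ℝ) < n := hs.delta_pos.trans hs.delta_lt
    exact_mod_cast this
  have hξ : (0 : ℝ) ≤ order ξ := Nat.cast_nonneg _
  obtain ⟨c, hc⟩ := exists_errorConst (σ := fun x => s x * monomial ξ x)
    (d := δ - n + order ξ) hn (hs.smooth.mul (contDiff_monomial ξ).contDiffOn)
    (fun t ht x hx => by
      rw [hs.map_smul ht hx, monomial_smul, Real.rpow_add ht, Real.rpow_natCast]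
      ring)
    (by linarith [hs.delta_pos])
  refine ⟨c, fun p N g hN hg hgc h0 => ?_⟩
  have := hc p N g (by linarith [(max_lt_iff.1 hN).1]) hg hgc h0
  have e1 : (n : ℝ) + (δ - n + order ξ) = order ξ + δ := by ring
  have e2 : (p : ℝ) + 1 + (δ - n + order ξ) + n = p + 1 + δ + order ξ := by ring
  simpa only [← mul_assoc, e1, e2] using this
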